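/- Let $M\subseteq \mathcal B(\mathcal H)$ be a von Neumann algebra on a complex Hilbert space $\mathcal H$ whose predual $M_*$ (the space of ultraweakly continuous linear functionals on $M$, with the dual norm) is norm separable. Let $(M)_1$ be the closed unit ball of $M$, endowed with the weak operator topology, and endow the set $\mathcal F((M)_1)$ of its closed subsets with the Vietoris topology, i.e. the topology generated by the sets $\{F : F\subseteq U\}$ and $\{F : F\cap U\neq\emptyset\}$ for $U\subseteq (M)_1$ open. Let $\mathcal G_{w*}(M)$ be the set of ultraweakly closed linear subspaces of $M$, endowed with the topology induced by the map $V\mapsto (V)_1=V\cap (M)_1\in\mathcal F((M)_1)$. Let $\mathcal S(M)\subseteq \mathcal G_{w*}(M)$ be the set of von Neumann subalgebras of $M$ with the same unit as $M$, endowed with the subspace topology. Then $\mathcal G_{w*}(M)$ is a Polish space, $\mathcal S(M)$ is a $G_\delta$ subset of $\mathcal G_{w*}(M)$, and in particular $\mathcal S(M)$ is a Polish space. -/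

import Mathlib

open scoped Topology InnerProductSpace

noncomputable section

namespace MarechalTopology

section Operators

variable (H : Type*) [NormedAddCommGroup H] [InnerProductSpace ℂ H] [CompleteSpace H]

/-- The ultraweak topology on `B(H)`: the weak-`*` topology of `B(H)` as the dual of the trace
class operators, i.e. the coarsest topology for which every functional
`x ↦ ∑ₙ ⟪ηₙ, x ξₙ⟫`, with `(ξₙ)` and `(ηₙ)` square summable sequences in `H`, is continuous.
(The series always converge absolutely.) -/
abbrev ultraweakTopology : TopologicalSpace (H →L[ℂ] H) :=
  ⨅ (ξ : lp (fun _ : ℕ => H) 2) (η : lp (fun _ : ℕ => H) 2),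
    TopologicalSpace.induced (fun x : H →L[ℂ] H => ∑' n, ⟪η n, x (ξ n)⟫_ℂ) inferInstance

/-- The weak (operator) topology on `B(H)`, transported from Mathlib's type copy. -/
abbrev weakTopology : TopologicalSpace (H →L[ℂ] H) :=
  TopologicalSpace.induced (ContinuousLinearMapWOT.ofCLM : (H →L[ℂ] H) → (H →WOT[ℂ] H))
    inferInstance

end Operators

/-- The Vietoris topology on the set of closed subsets of `X`, generated by the sets
`{F | F ⊆ U}` and `{F | F ∩ U ≠ ∅}` with `U` open. -/
abbrev vietorisTopology (X : Type*) [TopologicalSpace X] :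
    TopologicalSpace (TopologicalSpace.Closeds X) :=
  TopologicalSpace.induced (fun F : TopologicalSpace.Closeds X => (F : Set X))
    (TopologicalSpace.vietoris X)

variable {H : Type*} [NormedAddCommGroup H] [InnerProductSpace ℂ H] [CompleteSpace H]

/-- A von Neumann algebra as a linear subspace of `B(H)`. -/
def asSubmodule (M : VonNeumannAlgebra H) : Submodule ℂ (H →L[ℂ] H) :=
  Subalgebra.toSubmodule M.toStarSubalgebra.toSubalgebra

/-- The ultraweak topology on a von Neumann algebra. -/
abbrev ultraweakTopologyOn (M : VonNeumannAlgebra H) : TopologicalSpace (asSubmodule M) :=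
  TopologicalSpace.induced Subtype.val (ultraweakTopology H)

/-- The predual of `M`: the ultraweakly continuous elements of the norm dual of `M`, with the
norm of the dual. -/
def predual (M : VonNeumannAlgebra H) : Submodule ℂ (StrongDual ℂ (asSubmodule M)) where
  carrier := {φ | Continuous[ultraweakTopologyOn M, inferInstance] fun x => φ x}
  zero_mem' := by
    let _ := ultraweakTopologyOn M
    exact continuous_const
  add_mem' {φ ψ} hφ hψ :=
    @Continuous.add _ _ _ _ _ (ultraweakTopologyOn M) _ _ hφ hψ
  smul_mem' c φ hφ :=
    @Continuous.const_smul _ _ _ _ _ _ (ultraweakTopologyOn M) _ hφ c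

/-- The closed unit ball of `M`; it carries the weak topology (not the norm topology). -/
structure UnitBall (M : VonNeumannAlgebra H) where
  /-- The underlying operator. -/
  val : H →L[ℂ] H
  mem : val ∈ M
  norm_le : ‖val‖ ≤ 1

instance (M : VonNeumannAlgebra H) : TopologicalSpace (UnitBall M) :=
  TopologicalSpace.induced UnitBall.val (weakTopology H)

theorem continuous_inner_unitBall (M : VonNeumannAlgebra H) (ξ η : H) :
    Continuous fun x : UnitBall M => ⟪η, x.val ξ⟫_ℂ := by
  have h1 : Continuous fun x : UnitBall M =>
      (ContinuousLinearMapWOT.ofCLM x.val : H →WOT[ℂ] H) := by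
    rw [continuous_iff_le_induced]
    change TopologicalSpace.induced _ (TopologicalSpace.induced _ _) ≤ _
    rw [induced_compose]
    exact le_rfl
  exact (ContinuousLinearMapWOT.continuous_iff.1 h1) ξ η

/-- On the unit ball, the weak topology refines the ultraweak topology. -/
theorem continuous_val_ultraweak (M : VonNeumannAlgebra H) :
    Continuous[inferInstance, ultraweakTopology H] (UnitBall.val : UnitBall M → (H →L[ℂ] H)) := by
  refine continuous_iInf_rng.2 fun ξ => continuous_iInf_rng.2 fun η => continuous_induced_rng.2 ?_
  have hs : Summable fun n => ‖η n‖ * ‖ξ n‖ := by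
    refine lp.summable_mul ?_ η ξ
    rw [Real.holderConjugate_iff]
    norm_num
  refine continuous_tsum (fun n => continuous_inner_unitBall M (ξ n) (η n)) hs fun n x => ?_
  calc ‖⟪η n, x.val (ξ n)⟫_ℂ‖ ≤ ‖η n‖ * ‖x.val (ξ n)‖ := norm_inner_le_norm _ _
    _ ≤ ‖η n‖ * ‖ξ n‖ := by
        gcongr
        exact (x.val.le_of_opNorm_le x.norm_le _).trans (by simp)

/-- The grassmanian of `M`: the set of its ultraweakly closed linear subspaces. -/
structure Grassmannian (M : VonNeumannAlgebra H) where
  /-- The underlying linear subspace of `B(H)`. -/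
  toSubmodule : Submodule ℂ (H →L[ℂ] H)
  le : toSubmodule ≤ asSubmodule M
  isClosed : IsClosed[ultraweakTopology H] (toSubmodule : Set (H →L[ℂ] H))

/-- The unit ball of an ultraweakly closed subspace, as a weakly closed subset of that of `M`. -/
def Grassmannian.unitBall {M : VonNeumannAlgebra H} (V : Grassmannian M) :
    TopologicalSpace.Closeds (UnitBall M) where
  carrier := {x | x.val ∈ V.toSubmodule}
  isClosed' :=
    @IsClosed.preimage _ _ _ (ultraweakTopology H) _ (continuous_val_ultraweak M) _ V.isClosed

instance (M : VonNeumannAlgebra H) : TopologicalSpace (Grassmannian M) :=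
  TopologicalSpace.induced Grassmannian.unitBall (vietorisTopology (UnitBall M))

/-- The set `𝒮(M)` of von Neumann subalgebras of `M`. They have the same unit as `M`, since every
`VonNeumannAlgebra H` contains the identity operator of `H`. -/
structure Subalgebras (M : VonNeumannAlgebra H) where
  /-- The underlying von Neumann algebra. -/
  toVonNeumannAlgebra : VonNeumannAlgebra H
  le : toVonNeumannAlgebra ≤ M

theorem continuous_ultraweak_inner (ξ η : H) :
    Continuous[ultraweakTopology H, inferInstance] fun x : H →L[ℂ] H => ⟪η, x ξ⟫_ℂ := by
  let _ := ultraweakTopology H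
  have h : Continuous fun x : H →L[ℂ] H =>
      ∑' n, ⟪(lp.single (E := fun _ : ℕ => H) 2 0 η) n,
        x ((lp.single (E := fun _ : ℕ => H) 2 0 ξ) n)⟫_ℂ :=
    continuous_iff_le_induced.2 ((iInf_le _ _).trans (iInf_le _ _))
  convert h using 2 with x
  rw [tsum_eq_single 0]
  · simp
  · intro n hn
    simp [hn]

theorem isClosed_ultraweak_vonNeumannAlgebra (N : VonNeumannAlgebra H) :
    IsClosed[ultraweakTopology H] (asSubmodule N : Set (H →L[ℂ] H)) := by
  let _ := ultraweakTopology H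
  have h : (asSubmodule N : Set (H →L[ℂ] H)) =
      ⋂ y ∈ Set.centralizer (N : Set (H →L[ℂ] H)), ⋂ (ξ : H), ⋂ (η : H),
        {x : H →L[ℂ] H | ⟪η, x (y ξ)⟫_ℂ = ⟪ContinuousLinearMap.adjoint y η, x ξ⟫_ℂ} := by
    have h0 : (asSubmodule N : Set (H →L[ℂ] H)) =
      Set.centralizer (Set.centralizer (N : Set (H →L[ℂ] H))) := by
      rw [N.centralizer_centralizer]; rfl
    rw [h0]
    ext x
    simp only [Set.mem_iInter, Set.mem_ofPred_eq, ContinuousLinearMap.adjoint_inner_left]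
    rw [Set.mem_centralizer_iff]
    refine forall₂_congr fun y _ => ⟨fun h ξ η => ?_, fun h => ?_⟩
    · exact congrArg (fun z : H →L[ℂ] H => ⟪η, z ξ⟫_ℂ) h.symm
    · ext ξ
      exact (ext_inner_left ℂ fun η => h ξ η).symm
  rw [h]
  exact isClosed_biInter fun y _ => isClosed_iInter fun ξ => isClosed_iInter fun η =>
    isClosed_eq (continuous_ultraweak_inner _ _) (continuous_ultraweak_inner _ _)

/-- A von Neumann subalgebra of `M` as an element of the grassmanian of `M`. -/
def Subalgebras.toGrassmannian {M : VonNeumannAlgebra H} (N : Subalgebras M) :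
    Grassmannian M where
  toSubmodule := asSubmodule N.toVonNeumannAlgebra
  le := fun _ hx => N.le hx
  isClosed := isClosed_ultraweak_vonNeumannAlgebra N.toVonNeumannAlgebra

/-- `𝒮(M)` carries the topology of the grassmanian. -/
instance (M : VonNeumannAlgebra H) : TopologicalSpace (Subalgebras M) :=
  TopologicalSpace.induced Subalgebras.toGrassmannian inferInstance

end MarechalTopology

end

noncomputable section

namespace MarechalTopology

open Set TopologicalSpace Topology Filter

/-! ### The hyperspace of compact sets and its `Gδ` subsets. -/

section Compacts

/-! In the weak topology the unit ball of `M` is compact, and countably many dense functionals of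
the predual separate its points, so it is metrizable and its compact subsets form a Polish space. A
subspace is spanned by its unit ball, so the Grassmannian embeds in this hyperspace; everything
reduces to showing that the relevant sets of compact sets are `Gδ`.

A compact set `F` is the unit ball of an ultraweakly closed subspace iff it contains 0, is stable
under `a x + b y` with `|a| + |b| ≤ 1`, and contains `2x` whenever `x ∈ F` and `2x` is in the ball
of `M` (`range_compactBall`). The last condition forces `F` to be the whole ball of its span;
ultraweak closedness of the span is the Krein–Šmulian theorem, proved here for `B(H)`. Such a
subspace is a von Neumann algebra iff moreover `F` contains 1 and is stable under adjoints and
products, by the bicommutant theorem in its ultraweak form.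

All these are stability conditions under operations on a compact metrizable space, and
`isGδ_compacts_forall_mem` shows that each defines a `Gδ` set. Multiplication is only separately
weakly continuous, so that lemma must not assume joint continuity. -/

theorem _root_.IsGδ.polishSpace {X : Type*} [TopologicalSpace X] [PolishSpace X] {s : Set X}
    (hs : IsGδ s) : PolishSpace s := by
  obtain ⟨U, hU, rfl⟩ := isGδ_iff_eq_iInter_nat.1 hs
  have : ∀ n, PolishSpace (U n) := fun n => (hU n).polishSpace
  let f : (⋂ n, U n : Set X) → ∀ n, U n := fun x n => ⟨x, mem_iInter.1 x.2 n⟩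
  have hf : Continuous f := by fun_prop
  have hemb : IsEmbedding f := by
    refine IsEmbedding.of_comp hf (g := fun u => (u 0 : X)) (by fun_prop) ?_
    exact IsEmbedding.subtypeVal
  have hrange : range f = ⋂ n, {u | (u n : X) = u 0} := by
    ext u
    simp only [mem_range, mem_iInter, mem_ofPred_eq]
    constructor
    · rintro ⟨x, rfl⟩ n
      rfl
    · intro h
      refine ⟨⟨u 0, mem_iInter.2 fun n => h n ▸ (u n).2⟩, funext fun n => Subtype.ext (h n).symm⟩
  have : IsClosedEmbedding f := ⟨hemb, by
    rw [hrange]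
    exact isClosed_iInter fun n => isClosed_eq (by fun_prop) (by fun_prop)⟩
  exact this.polishSpace

section Compacts

variable {K X Y : Type*} [TopologicalSpace K] [TopologicalSpace X]

/-- Membership of `x` in `F` means that `F` and `{x}` are not disjoint, and disjointness of compact
sets is an open condition in the Vietoris topology. -/
theorem isClosed_mem_compacts [T2Space K] : IsClosed {p : Compacts K × K | p.2 ∈ p.1} := by
  have h : {p : Compacts K × K | p.2 ∈ p.1} =
      (fun p : Compacts K × K => (p.1, ({p.2} : Compacts K))) ⁻¹'
        {q | Disjoint (q.1 : Set K) q.2}ᶜ := by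
    ext p
    simp
  rw [h]
  refine IsClosed.preimage (continuous_fst.prodMk
    (Compacts.continuous_singleton.comp continuous_snd)) ?_
  exact Compacts.isOpen_setOfPred_disjoint_coe.isClosed_compl

theorem isOpen_dist_lt_compacts {K : Type*} [MetricSpace K] (ε : ℝ) :
    IsOpen {p : Compacts K × K | ∃ w ∈ p.1, dist p.2 w < ε} := by
  refine isOpen_iff_mem_nhds.2 ?_
  rintro ⟨F, z⟩ ⟨w, hw, hzw⟩
  obtain ⟨δ, hδ, hδε⟩ : ∃ δ > 0, dist z w + 2 * δ ≤ ε :=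
    ⟨(ε - dist z w) / 2, by simp only at hzw; linarith, by linarith⟩
  have h1 : {F : Compacts K | ((F : Set K) ∩ Metric.ball w δ).Nonempty} ∈ 𝓝 F :=
    (Compacts.isOpen_inter_nonempty_of_isOpen Metric.isOpen_ball).mem_nhds
      ⟨w, hw, Metric.mem_ball_self hδ⟩
  filter_upwards [prod_mem_nhds h1 (Metric.ball_mem_nhds z hδ)]
  rintro ⟨F', z'⟩ ⟨⟨w', hw', hww'⟩, hz'⟩
  refine ⟨w', hw', ?_⟩
  simp only [Metric.mem_ball] at hww' hz'
  have h2 := dist_triangle4 z' z w w'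
  rw [dist_comm w w'] at h2
  simp only
  linarith

/-- The compact sets closed under a separately continuous operation form a `Gδ` set. -/
theorem isGδ_compacts_forall_mem [T2Space K] [MetrizableSpace K] [CompactSpace X]
    [TopologicalSpace Y] [MetrizableSpace Y] [CompactSpace Y] {f : Y → X → K}
    (hf₁ : ∀ y, Continuous (f y)) (hf₂ : ∀ x, Continuous fun y => f y x)
    {R : Set (Compacts K × (Y × X))} (hR : IsClosed R) :
    IsGδ {F : Compacts K | ∀ y x, (F, (y, x)) ∈ R → f y x ∈ F} := by
  let _ := metrizableSpaceMetric K
  let _ := metrizableSpaceMetric Y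
  -- A quantified failure of stability: every `y'` near `y` sends `x` at least `1/(n+1)` away from
  -- `F`. Freezing `y'` makes `A n` closed using continuity in `x` alone; continuity in `y` puts
  -- every failure in some `A n`. Projecting along the compact factor `Y × X` keeps closedness, so
  -- the failures form an `Fσ` set.
  let A : ℕ → Set (Compacts K × (Y × X)) := fun n => R ∩ ⋂ y',
    {p | dist p.2.1 y' < 1 / (n + 1 : ℝ) ∧ ∃ w ∈ p.1, dist (f y' p.2.2) w < 1 / (n + 1 : ℝ)}ᶜ
  have hA : ∀ n, IsClosed (A n) := by
    refine fun n => hR.inter (isClosed_iInter fun y' => IsOpen.isClosed_compl ?_)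
    refine (isOpen_lt ((continuous_fst.comp continuous_snd).dist continuous_const)
      continuous_const).inter ?_
    have h2 : Continuous fun p : Compacts K × (Y × X) => (p.1, f y' p.2.2) :=
      continuous_fst.prodMk ((hf₁ y').comp (by fun_prop))
    exact (isOpen_dist_lt_compacts (1 / (n + 1 : ℝ))).preimage h2
  have heq : {F : Compacts K | ∀ y x, (F, (y, x)) ∈ R → f y x ∈ F} =
      ⋂ n, (Prod.fst '' A n)ᶜ := by
    ext F
    simp only [mem_ofPred_eq, mem_iInter, mem_compl_iff, mem_image, not_exists, not_and]
    constructor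
    · rintro h n ⟨F', y, x⟩ ⟨hR', hA'⟩ rfl
      refine mem_iInter.1 hA' y ⟨?_, f y x, h y x hR', ?_⟩ <;> simp only [dist_self] <;> positivity
    · intro h y x hR'
      by_contra hmem
      have hFc : IsClosed (F : Set K) := F.isCompact.isClosed
      obtain ⟨ε, hε, hball⟩ := Metric.isOpen_iff.1 hFc.isOpen_compl _ hmem
      obtain ⟨δ, hδ, hcont⟩ := Metric.continuous_iff.1 (hf₂ x) y (ε / 2) (by positivity)
      obtain ⟨n, hn⟩ := exists_nat_one_div_lt (lt_min hδ (half_pos hε))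
      refine h n (F, (y, x)) ⟨hR', mem_iInter.2 fun y' => ?_⟩ rfl
      rintro ⟨h1, w, hw, h2⟩
      simp only at h1 h2
      refine hball (?_ : w ∈ Metric.ball _ ε) hw
      have h3 := hcont y' (by rw [dist_comm]; exact h1.trans (hn.trans_le (min_le_left _ _)))
      have h4 := h2.trans (hn.trans_le (min_le_right _ _))
      rw [Metric.mem_ball]
      have h5 := dist_triangle w (f y' x) (f y x)
      rw [dist_comm w (f y' x)] at h5
      linarith
  rw [heq]
  exact IsGδ.iInter_of_isOpen fun n => (isClosedMap_fst_of_compactSpace _ (hA n)).isOpen_compl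

end Compacts

end Compacts

/-! ### Compactness and metrizability of the unit ball in the weak topology. -/

section UnitBall

variable {H : Type*} [NormedAddCommGroup H] [InnerProductSpace ℂ H] [CompleteSpace H]

theorem UnitBall.ext {M : VonNeumannAlgebra H} {x y : UnitBall M} (h : x.val = y.val) : x = y := by
  cases x; cases y; simp_all

theorem UnitBall.isInducing_inner (M : VonNeumannAlgebra H) :
    IsInducing fun (x : UnitBall M) (p : H × H) => ⟪p.2, x.val p.1⟫_ℂ := by
  have h1 : IsInducing fun x : UnitBall M => (ContinuousLinearMapWOT.ofCLM x.val : H →WOT[ℂ] H) :=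
    ⟨by
      change TopologicalSpace.induced _ (TopologicalSpace.induced _ _) = _
      rw [induced_compose]
      rfl⟩
  refine isInducing_iff_nhds.2 fun x => le_antisymm ?_ ?_
  · refine map_le_iff_le_comap.1 (Continuous.tendsto ?_ x)
    exact continuous_pi fun p => continuous_inner_unitBall M _ _
  · rw [h1.nhds_eq_comap, ← map_le_iff_le_comap]
    refine ContinuousLinearMapWOT.tendsto_iff_forall_inner_apply_tendsto.2 fun ξ η => ?_
    exact (((continuous_apply (ξ, η)).tendsto fun p : H × H => ⟪p.2, x.val p.1⟫_ℂ).comp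
      tendsto_comap :)

theorem UnitBall.continuous_iff {M : VonNeumannAlgebra H} {X : Type*} [TopologicalSpace X]
    {f : X → UnitBall M} :
    Continuous f ↔ ∀ ξ η : H, Continuous fun x => ⟪η, (f x).val ξ⟫_ℂ := by
  rw [(UnitBall.isInducing_inner M).continuous_iff, continuous_pi_iff]
  exact ⟨fun h ξ η => h (ξ, η), fun h p => h p.1 p.2⟩

instance (M : VonNeumannAlgebra H) : T2Space (UnitBall M) := by
  refine T2Space.of_injective_continuous ?_ (UnitBall.isInducing_inner M).continuous
  intro x y h
  refine UnitBall.ext (ContinuousLinearMap.ext fun ξ => ext_inner_left ℂ fun η => ?_)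
  exact congrFun h (ξ, η)

/-- A limit of contractions in the weak sense is represented by a contraction. -/
theorem exists_operator_of_tendsto_inner {ι : Type*} {l : Filter ι} [l.NeBot]
    {x : ι → H →L[ℂ] H} (hx : ∀ i, ‖x i‖ ≤ 1) {B : H → H → ℂ}
    (hB : ∀ ξ η, Tendsto (fun i => ⟪x i ξ, η⟫_ℂ) l (𝓝 (B ξ η))) :
    ∃ T : H →L[ℂ] H, ‖T‖ ≤ 1 ∧ ∀ ξ η, ⟪T ξ, η⟫_ℂ = B ξ η := by
  have hbound : ∀ ξ η, ‖B ξ η‖ ≤ 1 * ‖ξ‖ * ‖η‖ := fun ξ η => by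
    refine le_of_tendsto (hB ξ η).norm (Eventually.of_forall fun i => ?_)
    refine (norm_inner_le_norm _ _).trans ?_
    gcongr
    exact (x i).le_of_opNorm_le (hx i) ξ
  let L : H →ₗ⋆[ℂ] H →ₗ[ℂ] ℂ := LinearMap.mk₂'ₛₗ (starRingEnd ℂ) (RingHom.id ℂ) B
    (fun ξ ξ' η => tendsto_nhds_unique (hB _ _) (by
      simpa only [map_add, inner_add_left] using (hB ξ η).add (hB ξ' η)))
    (fun c ξ η => tendsto_nhds_unique (hB _ _) (by
      simpa only [map_smul, inner_smul_left, smul_eq_mul] using (hB ξ η).const_mul _))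
    (fun ξ η η' => tendsto_nhds_unique (hB _ _) (by
      simpa only [inner_add_right] using (hB ξ η).add (hB ξ η')))
    (fun c ξ η => tendsto_nhds_unique (hB _ _) (by
      simpa only [inner_smul_right, smul_eq_mul, RingHom.id_apply] using (hB ξ η).const_mul _))
  let T := InnerProductSpace.continuousLinearMapOfBilin (LinearMap.mkContinuous₂ L 1 hbound)
  have hT : ∀ ξ η, ⟪T ξ, η⟫_ℂ = B ξ η := fun ξ η => by
    rw [InnerProductSpace.continuousLinearMapOfBilin_apply]
    rfl
  refine ⟨T, ContinuousLinearMap.opNorm_le_bound _ zero_le_one fun ξ => ?_, hT⟩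
  rcases eq_or_ne (T ξ) 0 with h0 | h0
  · rw [h0, norm_zero]
    positivity
  · have h1 := hbound ξ (T ξ)
    rw [← hT, inner_self_eq_norm_sq_to_K, norm_pow, RCLike.norm_ofReal, abs_norm, sq] at h1
    exact le_of_mul_le_mul_right h1 (norm_pos_iff.2 h0)

/-- Commutation with a fixed `y` in the commutant passes to weak limits, since `y` can be moved to
the other side of the inner product; the bicommutant property then gives membership in `M`. -/
theorem mem_vonNeumannAlgebra_of_tendsto_inner (M : VonNeumannAlgebra H) {ι : Type*}
    {l : Filter ι} [l.NeBot] {x : ι → H →L[ℂ] H} (hx : ∀ i, x i ∈ M) {T : H →L[ℂ] H}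
    (hT : ∀ ξ η, Tendsto (fun i => ⟪η, x i ξ⟫_ℂ) l (𝓝 ⟪η, T ξ⟫_ℂ)) : T ∈ M := by
  rw [← SetLike.mem_coe, ← M.centralizer_centralizer, Set.mem_centralizer_iff]
  intro y hy
  refine ContinuousLinearMap.ext fun ξ => ext_inner_left ℂ fun η => ?_
  change ⟪η, y (T ξ)⟫_ℂ = ⟪η, T (y ξ)⟫_ℂ
  rw [← ContinuousLinearMap.adjoint_inner_left]
  refine tendsto_nhds_unique (hT ξ _) ((hT (y ξ) η).congr fun i => ?_)
  rw [ContinuousLinearMap.adjoint_inner_left]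
  exact congrArg (fun z : H →L[ℂ] H => ⟪η, z ξ⟫_ℂ) (Set.mem_centralizer_iff.1 hy _ (hx i))

/-- Along an ultrafilter all matrix coefficients converge, being bounded; the limit form is
represented by a contraction, which stays in `M`. -/
instance (M : VonNeumannAlgebra H) : CompactSpace (UnitBall M) := by
  refine ⟨isCompact_iff_ultrafilter_le_nhds.2 fun U _ => ?_⟩
  have hex : ∀ ξ η : H, ∃ b : ℂ, Tendsto (fun x : UnitBall M => ⟪x.val ξ, η⟫_ℂ) U (𝓝 b) := by
    intro ξ η
    have hc : IsCompact (Metric.closedBall (0 : ℂ) (1 * ‖ξ‖ * ‖η‖)) := isCompact_closedBall _ _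
    obtain ⟨b, -, hb⟩ := isCompact_iff_ultrafilter_le_nhds.1 hc
      (U.map fun x : UnitBall M => ⟪x.val ξ, η⟫_ℂ) (by
        refine tendsto_principal.2 (Eventually.of_forall fun x => ?_)
        rw [mem_closedBall_zero_iff]
        refine (norm_inner_le_norm _ _).trans ?_
        gcongr
        exact x.val.le_of_opNorm_le x.norm_le ξ)
    exact ⟨b, hb⟩
  choose B hB using hex
  obtain ⟨T, hT1, hT⟩ := exists_operator_of_tendsto_inner (fun x : UnitBall M => x.norm_le) hB
  have hlim : ∀ ξ η, Tendsto (fun x : UnitBall M => ⟪η, x.val ξ⟫_ℂ) U (𝓝 ⟪η, T ξ⟫_ℂ) := by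
    intro ξ η
    have h := (Complex.continuous_conj.tendsto _).comp (hB ξ η)
    rw [← hT, inner_conj_symm] at h
    exact h.congr fun x => inner_conj_symm _ _
  have hTM : T ∈ M := mem_vonNeumannAlgebra_of_tendsto_inner M (fun x : UnitBall M => x.mem) hlim
  refine ⟨⟨T, hTM, hT1⟩, mem_univ _, ?_⟩
  rw [(UnitBall.isInducing_inner M).nhds_eq_comap]
  exact map_le_iff_le_comap.1 (tendsto_pi_nhds.2 fun p => hlim p.1 p.2)

/-- The vector functional `x ↦ ⟪η, x ξ⟫` as an element of the predual. -/
def vectorFunctional (M : VonNeumannAlgebra H) (ξ η : H) : predual M :=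
  ⟨((innerSL ℂ η).comp (ContinuousLinearMap.apply ℂ H ξ)).comp (asSubmodule M).subtypeL, by
    let _ := ultraweakTopology H
    exact (continuous_ultraweak_inner ξ η).comp continuous_induced_dom⟩

/-- An element of the unit ball as an element of the algebra. -/
def UnitBall.toAlgebra {M : VonNeumannAlgebra H} (x : UnitBall M) : asSubmodule M :=
  ⟨x.val, x.mem⟩

theorem UnitBall.continuous_predual {M : VonNeumannAlgebra H} (φ : predual M) :
    Continuous fun x : UnitBall M => (φ : StrongDual ℂ (asSubmodule M)) x.toAlgebra := by
  have h1 : Continuous[inferInstance, ultraweakTopologyOn M]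
      (UnitBall.toAlgebra : UnitBall M → asSubmodule M) :=
    continuous_induced_rng.2 (continuous_val_ultraweak M)
  exact @Continuous.comp _ _ _ _ (ultraweakTopologyOn M) _ _ _ φ.2 h1

/-- Evaluation at a dense sequence of the predual is a continuous map to `ℕ → ℂ`, injective because
vector functionals separate operators, hence a closed embedding by compactness. -/
theorem UnitBall.metrizableSpace (M : VonNeumannAlgebra H) [SeparableSpace (predual M)] :
    MetrizableSpace (UnitBall M) := by
  obtain ⟨φ, hφ⟩ := exists_dense_seq (predual M)
  let f : UnitBall M → ℕ → ℂ := fun x n => (φ n : StrongDual ℂ (asSubmodule M)) x.toAlgebra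
  have hf : Continuous f := continuous_pi fun n => UnitBall.continuous_predual (φ n)
  have hinj : Function.Injective f := by
    intro x y hxy
    have hcont : ∀ z : asSubmodule M,
        Continuous fun ψ : predual M => (ψ : StrongDual ℂ (asSubmodule M)) z := fun z =>
      (ContinuousLinearMap.apply ℂ ℂ z).continuous.comp continuous_subtype_val
    have h : (fun ψ : predual M => (ψ : StrongDual ℂ (asSubmodule M)) x.toAlgebra) =
        fun ψ : predual M => (ψ : StrongDual ℂ (asSubmodule M)) y.toAlgebra :=
      hφ.equalizer (hcont _) (hcont _) hxy
    exact UnitBall.ext (ContinuousLinearMap.ext fun ξ => ext_inner_left ℂ fun η =>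
      congrFun h (vectorFunctional M ξ η))
  exact (hf.isClosedEmbedding hinj).metrizableSpace

end UnitBall

/-! ### Approximating weakly continuous functionals by sums of vector functionals with controlled
size. -/

section WeakFunctionals

/-- Finite dimensional minimax: if every point of a compact convex set has a small coordinate, then
some convex combination of the coordinates is small on the whole set. -/
theorem exists_weights_sum_lt {ι : Type*} [Fintype ι] {S : Set (ι → ℝ)} (hconv : Convex ℝ S)
    (hcomp : IsCompact S) (h0 : 0 ∈ S) {δ : ℝ} (hS : ∀ z ∈ S, ∃ i, z i < δ) :
    ∃ μ : ι → ℝ, (∀ i, 0 ≤ μ i) ∧ ∑ i, μ i = 1 ∧ ∀ z ∈ S, ∑ i, μ i * z i < δ := by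
  classical
  -- By hypothesis `S` misses the orthant of points with all coordinates at least `δ`. The
  -- coefficients of a separating functional, once normalised, are the weights.
  obtain ⟨f, u, v, hu, huv, hv⟩ := geometric_hahn_banach_compact_closed hconv hcomp
    (convex_Ici (fun _ : ι => δ)) isClosed_Ici (disjoint_left.2 fun z hz hz' => by
      obtain ⟨i, hi⟩ := hS z hz
      exact (hz' i).not_gt hi)
  set w : ι → ℝ := fun i => f (Pi.single i 1) with hw
  have hf : ∀ z, f z = ∑ i, w i * z i := fun z => by
    conv_lhs => rw [pi_eq_sum_univ' z, map_sum]
    refine Finset.sum_congr rfl fun i _ => ?_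
    rw [map_smul, smul_eq_mul, mul_comm]
  have hw0 : ∀ i, 0 ≤ w i := by
    intro i
    by_contra! hi
    have hq := hv (fun _ => δ) self_mem_Ici
    -- If `w i < 0`, moving this far along the `i`-th axis stays in the orthant but brings `f` down
    -- to exactly `v`.
    set s : ℝ := (f (fun _ => δ) - v) / (-w i) with hs
    have hs0 : 0 ≤ s := div_nonneg (by linarith) (by linarith)
    have h1 := hv ((fun _ => δ) + s • Pi.single i 1) (by
      refine mem_Ici.2 (le_add_of_nonneg_right (smul_nonneg hs0 ?_))
      exact Pi.single_nonneg.2 zero_le_one)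
    rw [map_add, map_smul, smul_eq_mul] at h1
    have h2 : s * f (Pi.single i 1) = -(f (fun _ => δ) - v) := by
      change s * w i = _
      rw [hs]
      field_simp [hi.ne]
    linarith
  have hfδ : v < δ * ∑ i, w i := by
    have := hv (fun _ => δ) self_mem_Ici
    rwa [hf, ← Finset.sum_mul, mul_comm] at this
  -- The hypothesis `0 ∈ S` makes `u`, hence `v`, positive; this rules out a vanishing total weight.
  have hu0 : 0 < u := by simpa using hu 0 h0
  have hsum : 0 < ∑ i, w i := by
    refine (Finset.sum_nonneg fun i _ => hw0 i).lt_of_ne fun h => ?_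
    rw [← h, mul_zero] at hfδ
    linarith
  refine ⟨fun i => w i / ∑ i, w i, fun i => div_nonneg (hw0 i) hsum.le, ?_, fun z hz => ?_⟩
  · rw [← Finset.sum_div, div_self hsum.ne']
  · have h1 := hu z hz
    rw [hf] at h1
    simp_rw [div_mul_eq_mul_div]
    rw [← Finset.sum_div, div_lt_iff₀ hsum]
    linarith

variable {H : Type*} [NormedAddCommGroup H] [InnerProductSpace ℂ H]

/-- The functional `x ↦ ⟪η, x ξ⟫`, continuous for the weak operator topology. -/
def wotFunctional [CompleteSpace H] (ξ η : H) : (H →WOT[ℂ] H) →L[ℂ] ℂ where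
  toFun x := ⟪η, x ξ⟫_ℂ
  map_add' x y := by simp
  map_smul' c x := by simp
  cont := ContinuousLinearMapWOT.continuous_inner_apply continuous_id ξ η

@[simp]
theorem wotFunctional_apply [CompleteSpace H] (ξ η : H) (x : H →WOT[ℂ] H) :
    wotFunctional ξ η x = ⟪η, x ξ⟫_ℂ := rfl

/-- The unit ball of a subspace of `B(H)`, in the type copy carrying the weak operator topology. -/
def wotUnitBall (V : Submodule ℂ (H →L[ℂ] H)) : Set (H →WOT[ℂ] H) :=
  {x | x.toCLM ∈ V ∧ ‖x.toCLM‖ ≤ 1}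

theorem zero_mem_wotUnitBall (V : Submodule ℂ (H →L[ℂ] H)) : 0 ∈ wotUnitBall V := by
  simp [wotUnitBall]

theorem smul_mem_wotUnitBall {V : Submodule ℂ (H →L[ℂ] H)} {x : H →WOT[ℂ] H}
    (hx : x ∈ wotUnitBall V) {c : ℂ} (hc : ‖c‖ ≤ 1) : c • x ∈ wotUnitBall V := by
  refine ⟨V.smul_mem c hx.1, ?_⟩
  rw [ContinuousLinearMapWOT.toCLM_smul, norm_smul]
  exact mul_le_one₀ hc (norm_nonneg _) hx.2

theorem convex_wotUnitBall (V : Submodule ℂ (H →L[ℂ] H)) : Convex ℝ (wotUnitBall V) := by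
  intro x hx y hy a b ha hb hab
  refine ⟨?_, ?_⟩
  · exact V.add_mem (V.smul_of_tower_mem a hx.1) (V.smul_of_tower_mem b hy.1)
  · refine (norm_add_le (a • x.toCLM) (b • y.toCLM)).trans ?_
    rw [norm_smul, norm_smul, Real.norm_of_nonneg ha, Real.norm_of_nonneg hb, ← hab]
    exact add_le_add (mul_le_of_le_one_right ha hx.2) (mul_le_of_le_one_right hb hy.2)

/-- The ball is stable under unimodular scalars, so the value of `φ` can be rotated onto the
positive axis. -/
theorem norm_le_of_re_le_of_mem_wotUnitBall {V : Submodule ℂ (H →L[ℂ] H)}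
    (φ : (H →WOT[ℂ] H) →L[ℂ] ℂ) {r : ℝ} (h : ∀ x ∈ wotUnitBall V, (φ x).re ≤ r) :
    ∀ x ∈ wotUnitBall V, ‖φ x‖ ≤ r := by
  intro x hx
  obtain ⟨c, hc, hcx⟩ := Complex.exists_norm_eq_mul_self (φ x)
  have h1 := h (c • x) (smul_mem_wotUnitBall hx hc.le)
  rwa [map_smul, smul_eq_mul, ← hcx, Complex.ofReal_re] at h1

theorem norm_le_mul_norm_of_mem {V : Submodule ℂ (H →L[ℂ] H)} {φ : (H →WOT[ℂ] H) →L[ℂ] ℂ} {r : ℝ}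
    (h : ∀ x ∈ wotUnitBall V, ‖φ x‖ ≤ r) {x : H →WOT[ℂ] H} (hx : x.toCLM ∈ V) :
    ‖φ x‖ ≤ r * ‖x.toCLM‖ := by
  rcases eq_or_ne x 0 with rfl | hx0
  · simp
  have hpos : 0 < ‖x.toCLM‖ := norm_pos_iff.2 fun h0 =>
    hx0 (ContinuousLinearMapWOT.toCLM_injective h0)
  have h1 := h (((‖x.toCLM‖⁻¹ : ℝ) : ℂ) • x) ⟨V.smul_mem _ hx, by
    rw [ContinuousLinearMapWOT.toCLM_smul, norm_smul, Complex.norm_real, norm_inv, norm_norm,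
      inv_mul_cancel₀ hpos.ne']⟩
  rw [map_smul, norm_smul, Complex.norm_real, norm_inv, norm_norm, inv_mul_le_iff₀ hpos] at h1
  linarith

theorem exists_lt_re_inner (x : H →L[ℂ] H) {ε : ℝ} (hε : 0 < ε) :
    ∃ ξ η : H, ‖ξ‖ ≤ 1 ∧ ‖η‖ ≤ 1 ∧ ‖x‖ - ε < (⟪η, x ξ⟫_ℂ).re := by
  obtain ⟨ξ, hξ, hlt⟩ := x.exists_lt_apply_of_lt_opNorm (sub_lt_self ‖x‖ hε)
  refine ⟨ξ, ((‖x ξ‖⁻¹ : ℝ) : ℂ) • x ξ, hξ.le, ?_, ?_⟩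
  · rw [norm_smul, Complex.norm_real, norm_inv, norm_norm]
    exact inv_mul_le_one
  · refine hlt.trans_eq ?_
    rw [inner_smul_left, Complex.conj_ofReal, inner_self_eq_norm_sq_to_K]
    rcases eq_or_ne (‖x ξ‖) 0 with h | h
    · simp [h]
    · rw [Complex.re_ofReal_mul]
      have h1 : (((‖x ξ‖ : ℝ) : ℂ) ^ 2).re = ‖x ξ‖ ^ 2 := by
        rw [← Complex.ofReal_pow, Complex.ofReal_re]
      refine Eq.trans ?_ (congrArg _ h1.symm)
      field_simp

/-- Up to half of its size, a functional on the compact unit ball of `V` is given by a finite sum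
of vector functionals. -/
theorem exists_finite_sum_approx [CompleteSpace H] {V : Submodule ℂ (H →L[ℂ] H)}
    (hV : IsCompact (wotUnitBall V)) (φ : (H →WOT[ℂ] H) →L[ℂ] ℂ) {r : ℝ} (hr : 0 < r)
    (hφ : ∀ x ∈ wotUnitBall V, ‖φ x‖ ≤ r) :
    ∃ (t : Finset (H × H)) (ξ η : t → H), ∑ i, ‖ξ i‖ ^ 2 ≤ r ∧ ∑ i, ‖η i‖ ^ 2 ≤ r ∧
      ∀ x ∈ wotUnitBall V, ‖(φ - ∑ i, wotFunctional (ξ i) (η i)) x‖ ≤ r / 2 := by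
  classical
  -- These sets cover the ball: `Re φ(x) ≤ r ‖x‖`, and some pair in the unit ball of `H` nearly
  -- attains `‖x‖`. Compactness leaves finitely many pairs, and the minimax lemma replaces the
  -- choice of pair depending on `x` by one convex combination.
  let U : {p : H × H // ‖p.1‖ ≤ 1 ∧ ‖p.2‖ ≤ 1} → Set (H →WOT[ℂ] H) := fun p =>
    {x | (φ x).re - r * (⟪p.1.2, x p.1.1⟫_ℂ).re < r / 2}
  have hU : ∀ p, IsOpen (U p) := fun p => by
    refine isOpen_lt (.sub (Complex.continuous_re.comp φ.continuous)
      (.mul continuous_const (Complex.continuous_re.comp ?_))) continuous_const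
    exact (wotFunctional p.1.1 p.1.2).continuous
  obtain ⟨t₀, ht₀⟩ := hV.elim_finite_subcover U hU fun x hx => by
    obtain ⟨ξ, η, hξ, hη, h⟩ := exists_lt_re_inner x.toCLM (half_pos one_pos)
    refine mem_iUnion.2 ⟨⟨(ξ, η), hξ, hη⟩, ?_⟩
    have h1 := (Complex.re_le_norm _).trans (norm_le_mul_norm_of_mem hφ hx.1)
    have h2 := mul_lt_mul_of_pos_left h hr
    change (φ x).re - r * (⟪η, x.toCLM ξ⟫_ℂ).re < r / 2
    linarith
  let t : Finset (H × H) := t₀.map (Function.Embedding.subtype _)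
  have htU : ∀ x ∈ wotUnitBall V, ∃ p : t, (φ x).re - r * (⟪p.1.2, x p.1.1⟫_ℂ).re < r / 2 := by
    intro x hx
    obtain ⟨p, hp, hpx⟩ := mem_iUnion₂.1 (ht₀ hx)
    exact ⟨⟨p.1, Finset.mem_map_of_mem _ hp⟩, hpx⟩
  have ht1 : ∀ p : t, ‖p.1.1‖ ≤ 1 ∧ ‖p.1.2‖ ≤ 1 := by
    rintro ⟨p, hp⟩
    obtain ⟨q, -, rfl⟩ := Finset.mem_map.1 hp
    exact q.2
  let T : (H →WOT[ℂ] H) →L[ℝ] (t → ℝ) := ContinuousLinearMap.pi fun p =>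
    Complex.reCLM ∘L (φ - (r : ℂ) • wotFunctional p.1.1 p.1.2).restrictScalars ℝ
  have hT : ∀ x p, T x p = (φ x).re - r * (⟪p.1.2, x p.1.1⟫_ℂ).re := fun x p => by
    simp [T]
  obtain ⟨μ, hμ0, hμ1, hμ⟩ := exists_weights_sum_lt (S := T '' wotUnitBall V) (δ := r / 2)
    ((convex_wotUnitBall V).linear_image T.toLinearMap) (hV.image T.continuous)
    ⟨0, zero_mem_wotUnitBall V, map_zero T⟩ (by
      rintro _ ⟨x, hx, rfl⟩
      obtain ⟨p, hp⟩ := htU x hx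
      exact ⟨p, (hT x p).trans_lt hp⟩)
  -- The coefficient `r * μ p` is split as a square root on each of the two vectors, so both
  -- families have square sums at most `r`.
  have hnorm : ∀ (p : t) (a : H), ‖a‖ ≤ 1 → ‖((√(r * μ p) : ℝ) : ℂ) • a‖ ^ 2 ≤ r * μ p := by
    intro p a ha
    rw [norm_smul, Complex.norm_real, mul_pow, Real.norm_of_nonneg (Real.sqrt_nonneg _),
      Real.sq_sqrt (mul_nonneg hr.le (hμ0 p))]
    exact mul_le_of_le_one_right (mul_nonneg hr.le (hμ0 p)) (pow_le_one₀ (norm_nonneg _) ha)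
  have hsum : ∑ p, r * μ p = r := by rw [← Finset.mul_sum, hμ1, mul_one]
  refine ⟨t, fun p => ((√(r * μ p) : ℝ) : ℂ) • p.1.1, fun p => ((√(r * μ p) : ℝ) : ℂ) • p.1.2,
    (Finset.sum_le_sum fun p _ => hnorm p _ (ht1 p).1).trans hsum.le,
    (Finset.sum_le_sum fun p _ => hnorm p _ (ht1 p).2).trans hsum.le, ?_⟩
  refine norm_le_of_re_le_of_mem_wotUnitBall _ fun x hx => ?_
  refine (le_of_eq ?_).trans (hμ _ ⟨x, hx, rfl⟩).le
  simp_rw [hT, mul_sub, Finset.sum_sub_distrib, ← Finset.sum_mul, hμ1, one_mul]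
  rw [sub_apply, Complex.sub_re, sum_apply, Complex.re_sum]
  congr 1
  refine Finset.sum_congr rfl fun p _ => ?_
  rw [wotFunctional_apply, map_smul, inner_smul_left, inner_smul_right, Complex.conj_ofReal,
    ← mul_assoc, ← Complex.ofReal_mul, Real.mul_self_sqrt (mul_nonneg hr.le (hμ0 p)),
    Complex.re_ofReal_mul]
  ring

end WeakFunctionals

/-! ### Ultraweakly continuous functionals and the Krein–Šmulian theorem. -/

section KreinSmulian

variable {H : Type*} [NormedAddCommGroup H] [InnerProductSpace ℂ H]

/-- The ultraweakly continuous functional `x ↦ ∑ₙ ⟪ηₙ, x ξₙ⟫`. -/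
def uwFunctional (ξ η : lp (fun _ : ℕ => H) 2) (x : H →L[ℂ] H) : ℂ := ∑' n, ⟪η n, x (ξ n)⟫_ℂ

theorem continuous_uwFunctional (ξ η : lp (fun _ : ℕ => H) 2) :
    Continuous[ultraweakTopology H, inferInstance] (uwFunctional ξ η) := by
  let _ := ultraweakTopology H
  exact continuous_iff_le_induced.2 ((iInf_le _ _).trans (iInf_le _ _))

theorem summable_norm_mul_norm {E : Type*} [NormedAddCommGroup E] (ξ η : lp (fun _ : ℕ => E) 2) :
    (Summable fun n => ‖η n‖ * ‖ξ n‖) ∧ ∑' n, ‖η n‖ * ‖ξ n‖ ≤ ‖η‖ * ‖ξ‖ :=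
  lp.tsum_mul_le_mul_norm (by rw [Real.holderConjugate_iff]; norm_num) η ξ

theorem norm_inner_apply_le (x : H →L[ℂ] H) (ξ η : H) : ‖⟪η, x ξ⟫_ℂ‖ ≤ ‖x‖ * (‖η‖ * ‖ξ‖) := by
  refine (norm_inner_le_norm _ _).trans ?_
  have := mul_le_mul_of_nonneg_left (x.le_opNorm ξ) (norm_nonneg η)
  linarith

theorem norm_uwFunctional_le (ξ η : lp (fun _ : ℕ => H) 2) (x : H →L[ℂ] H) :
    ‖uwFunctional ξ η x‖ ≤ ‖x‖ * (‖η‖ * ‖ξ‖) := by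
  obtain ⟨hs, hle⟩ := summable_norm_mul_norm ξ η
  refine (tsum_of_norm_bounded (hs.hasSum.mul_left ‖x‖) fun n => norm_inner_apply_le x _ _).trans ?_
  gcongr

/-- A square summable family extends by zero along an injective map. -/
theorem exists_lp_extend {E : Type*} [NormedAddCommGroup E] {J ι : Type*} {e : J → ι}
    (he : Function.Injective e) {ξ : J → E} (hξ : Summable fun j => ‖ξ j‖ ^ 2) :
    ∃ ξ' : lp (fun _ : ι => E) 2, (∀ n, ξ' n = Function.extend e ξ 0 n) ∧
      ‖ξ'‖ ^ 2 = ∑' j, ‖ξ j‖ ^ 2 := by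
  have hext : ∀ n, ‖Function.extend e ξ 0 n‖ ^ (2 : ENNReal).toReal =
      Function.extend e (fun j => ‖ξ j‖ ^ 2) 0 n := by
    intro n
    rw [ENNReal.toReal_ofNat, Real.rpow_ofNat]
    by_cases hn : ∃ j, e j = n
    · obtain ⟨j, rfl⟩ := hn
      rw [he.extend_apply, he.extend_apply]
    · rw [Function.extend_apply' _ _ _ hn, Function.extend_apply' _ _ _ hn]
      simp
  have hsum : HasSum (fun n => ‖Function.extend e ξ 0 n‖ ^ (2 : ENNReal).toReal)
      (∑' j, ‖ξ j‖ ^ 2) := by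
    simp_rw [hext]
    exact (hasSum_extend_zero he).2 hξ.hasSum
  let f : lp (fun _ : ι => E) 2 := ⟨Function.extend e ξ 0, memℓp_gen hsum.summable⟩
  refine ⟨f, fun n => rfl, ?_⟩
  have h2 : ‖f‖ ^ (2 : ENNReal).toReal = ∑' j, ‖ξ j‖ ^ 2 :=
    (lp.norm_rpow_eq_tsum (by norm_num) f).trans hsum.tsum_eq
  rwa [ENNReal.toReal_ofNat, Real.rpow_ofNat] at h2

theorem exists_uwFunctional_of_countable {J : Type*} [Countable J] {ξ η : J → H}
    (hξ : Summable fun j => ‖ξ j‖ ^ 2) (hη : Summable fun j => ‖η j‖ ^ 2) :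
    ∃ ξ' η' : lp (fun _ : ℕ => H) 2, ‖ξ'‖ ^ 2 = ∑' j, ‖ξ j‖ ^ 2 ∧ ‖η'‖ ^ 2 = ∑' j, ‖η j‖ ^ 2 ∧
      ∀ x, HasSum (fun j => ⟪η j, x (ξ j)⟫_ℂ) (uwFunctional ξ' η' x) := by
  obtain ⟨e, he⟩ := exists_injective_nat J
  obtain ⟨ξ', hξ', hξn⟩ := exists_lp_extend he hξ
  obtain ⟨η', hη', hηn⟩ := exists_lp_extend he hη
  refine ⟨ξ', η', hξn, hηn, fun x => (hasSum_extend_zero he).1 ?_⟩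
  have h : Function.extend e (fun j => ⟪η j, x (ξ j)⟫_ℂ) 0 = fun n => ⟪η' n, x (ξ' n)⟫_ℂ := by
    ext n
    rw [hξ', hη']
    by_cases hn : ∃ j, e j = n
    · obtain ⟨j, rfl⟩ := hn
      simp only [he.extend_apply]
    · rw [Function.extend_apply' _ _ _ hn, Function.extend_apply' _ _ _ hn]
      simp
  rw [h]
  refine Summable.hasSum (Summable.of_norm_bounded
    ((summable_norm_mul_norm ξ' η').1.mul_left ‖x‖) fun n => norm_inner_apply_le x _ _)

variable [CompleteSpace H]

theorem summable_and_tsum_le_of_sum_le {u : ℕ → Type*} [∀ n, Fintype (u n)]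
    {f : (Σ n, u n) → ℝ} (hf : ∀ p, 0 ≤ f p) {r : ℝ}
    (h : ∀ n, ∑ i, f ⟨n, i⟩ ≤ r / 2 / 2 ^ n) : Summable f ∧ ∑' p, f p ≤ r := by
  have hg : Summable fun n => ∑' i, f ⟨n, i⟩ := by
    refine Summable.of_nonneg_of_le (fun n => tsum_nonneg fun i => hf _) (fun n => ?_)
      (summable_geometric_two' r)
    rw [tsum_fintype]
    exact h n
  have hs : Summable f := (summable_sigma_of_nonneg hf).2 ⟨fun n => .of_finite, hg⟩
  refine ⟨hs, ?_⟩
  rw [hs.tsum_sigma' fun n => .of_finite, ← tsum_geometric_two' r]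
  refine hg.tsum_le_tsum (fun n => ?_) (summable_geometric_two' r)
  rw [tsum_fintype]
  exact h n

/-- On a subspace whose unit ball is weakly compact, a weakly continuous functional agrees with an
ultraweakly continuous functional whose norm is controlled by the norm on the subspace. -/
theorem exists_uwFunctional_eqOn {V : Submodule ℂ (H →L[ℂ] H)}
    (hV : IsCompact (wotUnitBall V)) (φ : (H →WOT[ℂ] H) →L[ℂ] ℂ) {r : ℝ} (hr : 0 < r)
    (hφ : ∀ x ∈ wotUnitBall V, ‖φ x‖ ≤ r) :
    ∃ ξ η : lp (fun _ : ℕ => H) 2, (∀ x, ‖uwFunctional ξ η x‖ ≤ 2 * r * ‖x‖) ∧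
      ∀ x : H →WOT[ℂ] H, x.toCLM ∈ V → φ x = uwFunctional ξ η x.toCLM := by
  -- The bounds are moved behind the existential, with an empty sum as default, so that `choose`
  -- gives total functions usable in a recursion.
  have hstep : ∀ (ψ : (H →WOT[ℂ] H) →L[ℂ] ℂ) (s : ℝ), ∃ (t : Finset (H × H)) (ξ η : t → H),
      0 < s → (∀ x ∈ wotUnitBall V, ‖ψ x‖ ≤ s) →
      ∑ i, ‖ξ i‖ ^ 2 ≤ s ∧ ∑ i, ‖η i‖ ^ 2 ≤ s ∧
      ∀ x ∈ wotUnitBall V, ‖(ψ - ∑ i, wotFunctional (ξ i) (η i)) x‖ ≤ s / 2 := by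
    intro ψ s
    by_cases h : 0 < s ∧ ∀ x ∈ wotUnitBall V, ‖ψ x‖ ≤ s
    · obtain ⟨t, ξ, η, h'⟩ := exists_finite_sum_approx hV ψ h.1 h.2
      exact ⟨t, ξ, η, fun _ _ => h'⟩
    · exact ⟨∅, 0, 0, fun h1 h2 => (h ⟨h1, h2⟩).elim⟩
  choose t ξ η hstep using hstep
  -- This is `r / 2 ^ n`, the size of the remainder after `n` halvings, written as a geometric
  -- series of sum `2 * r`. That sum bounds the total square norms, whence the factor 2 in the
  -- conclusion.
  let s : ℕ → ℝ := fun n => 2 * r / 2 / 2 ^ n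
  have hs : ∀ n, 0 < s n := fun n => by positivity
  let ψ : ℕ → ((H →WOT[ℂ] H) →L[ℂ] ℂ) := fun n => Nat.rec φ
    (fun n χ => χ - ∑ i, wotFunctional (ξ χ (s n) i) (η χ (s n) i)) n
  have hψ : ∀ n, ψ (n + 1) =
    ψ n - ∑ i, wotFunctional (ξ (ψ n) (s n) i) (η (ψ n) (s n) i) := fun n => rfl
  have hbound : ∀ n, ∀ x ∈ wotUnitBall V, ‖ψ n x‖ ≤ s n := by
    intro n
    induction n with
    | zero => simpa [s, ψ] using hφ
    | succ n ih =>
      intro x hx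
      refine ((hstep _ _ (hs n) ih).2.2 x hx).trans_eq ?_
      simp only [s, pow_succ]
      ring
  have h1 := fun n => hstep (ψ n) (s n) (hs n) (hbound n)
  let J := Σ n, t (ψ n) (s n)
  obtain ⟨hξs, hξr⟩ := summable_and_tsum_le_of_sum_le
    (f := fun p : J => ‖ξ (ψ p.1) (s p.1) p.2‖ ^ 2) (r := 2 * r) (fun p => by positivity)
    fun n => (h1 n).1
  obtain ⟨hηs, hηr⟩ := summable_and_tsum_le_of_sum_le
    (f := fun p : J => ‖η (ψ p.1) (s p.1) p.2‖ ^ 2) (r := 2 * r) (fun p => by positivity)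
    fun n => (h1 n).2.1
  obtain ⟨ξ', η', hξ', hη', hsum⟩ := exists_uwFunctional_of_countable hξs hηs
  refine ⟨ξ', η', fun x => ?_, fun x hx => ?_⟩
  · refine (norm_uwFunctional_le ξ' η' x).trans ?_
    rw [mul_comm]
    refine mul_le_mul_of_nonneg_right ?_ (norm_nonneg x)
    linarith [two_mul_le_add_sq ‖η'‖ ‖ξ'‖]
  · have h2 := (hsum x.toCLM).sigma fun n => hasSum_fintype _
    refine tendsto_nhds_unique (f := fun n : ℕ => φ x - ψ n x) ?_ (h2.tendsto_sum_nat.congr ?_)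
    · have h3 : Tendsto (fun n => ψ n x) atTop (𝓝 0) := by
        refine squeeze_zero_norm (a := fun n => s n * ‖x.toCLM‖) (fun n =>
          norm_le_mul_norm_of_mem (hbound n) hx) ?_
        rw [← zero_mul ‖x.toCLM‖]
        exact (summable_geometric_two' (2 * r)).tendsto_atTop_zero.mul_const _
      simpa using h3.const_sub (φ x)
    · intro n
      induction n with
      | zero => simp [ψ]
      | succ n ih =>
        rw [Finset.sum_range_succ, ih, hψ, sub_apply, sum_apply]
        simp only [wotFunctional_apply, ContinuousLinearMapWOT.toCLM_apply]
        ring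

theorem continuous_ofCLM_ultraweak :
    Continuous[ultraweakTopology H, inferInstance]
      (ContinuousLinearMapWOT.ofCLM : (H →L[ℂ] H) → (H →WOT[ℂ] H)) := by
  let _ := ultraweakTopology H
  exact ContinuousLinearMapWOT.continuous_iff.2 fun ξ η => continuous_ultraweak_inner ξ η

/-- The Krein–Šmulian theorem for subspaces of `B(H)`. -/
theorem isClosed_ultraweak_of_isCompact_wotUnitBall {V : Submodule ℂ (H →L[ℂ] H)}
    (hV : IsCompact (wotUnitBall V)) :
    IsClosed[ultraweakTopology H] (V : Set (H →L[ℂ] H)) := by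
  let τ := ultraweakTopology H
  refine (@closure_subset_iff_isClosed _ τ _).1 fun x₀ hx₀ => ?_
  -- On `V`, `φ` equals an ultraweakly continuous functional of norm at most `2 * r`. The equality
  -- extends to the ultraweak closure, and with it the bound.
  have hmain : ∀ (φ : (H →WOT[ℂ] H) →L[ℂ] ℂ) (r : ℝ), 0 < r →
      (∀ x ∈ wotUnitBall V, ‖φ x‖ ≤ r) →
      ‖φ (ContinuousLinearMapWOT.ofCLM x₀)‖ ≤ 2 * r * ‖x₀‖ := by
    intro φ r hr hφ
    obtain ⟨ξ, η, hle, heq⟩ := exists_uwFunctional_eqOn hV φ hr hφ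
    have hcl : @IsClosed _ τ {x : H →L[ℂ] H |
        φ (ContinuousLinearMapWOT.ofCLM x) = uwFunctional ξ η x} :=
      @isClosed_eq _ _ _ τ _ _ _ (@Continuous.comp _ _ _ τ _ _ _ _ φ.continuous
        continuous_ofCLM_ultraweak) (continuous_uwFunctional ξ η)
    have h0 := @closure_minimal _ τ _ _ (fun x hx => heq (ContinuousLinearMapWOT.ofCLM x) hx)
      hcl x₀ hx₀
    rw [h0]
    exact hle x₀
  -- The factor 2 absorbs the loss in `hmain`, so no weakly continuous functional can separate `x₀ /
  -- c` from the ball; the 1 keeps `c` nonzero. It is harmless that `c` exceeds `‖x₀‖`, as `V` is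
  -- stable under scaling.
  set c : ℝ := 2 * ‖x₀‖ + 1 with hc
  have hc0 : 0 < c := by positivity
  have hc0' : (c : ℂ) ≠ 0 := by exact_mod_cast hc0.ne'
  set y : H →WOT[ℂ] H := (c : ℂ)⁻¹ • ContinuousLinearMapWOT.ofCLM x₀ with hy
  have hyV : y ∈ wotUnitBall V := by
    by_contra hyV
    obtain ⟨φ, u, hu, huy⟩ := RCLike.geometric_hahn_banach_closed_point (𝕜 := ℂ)
      (convex_wotUnitBall V) hV.isClosed hyV
    have hu0 : 0 < u := by simpa using hu 0 (zero_mem_wotUnitBall V)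
    have h1 := hmain φ u hu0 (norm_le_of_re_le_of_mem_wotUnitBall φ fun x hx => (hu x hx).le)
    have h2 : ‖φ y‖ ≤ u := by
      rw [hy, map_smul, norm_smul, norm_inv, Complex.norm_real, Real.norm_of_nonneg hc0.le,
        inv_mul_le_iff₀ hc0]
      nlinarith [norm_nonneg x₀]
    exact (huy.trans_le ((Complex.re_le_norm _).trans h2)).false
  have h3 : x₀ = (c : ℂ) • y.toCLM := by
    rw [hy, ContinuousLinearMapWOT.toCLM_smul, smul_smul, mul_inv_cancel₀ hc0', one_smul]
  rw [h3]
  exact V.smul_mem _ hyV.1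

end KreinSmulian

/-! ### Amplifications and the bicommutant theorem. -/

section Bicommutant

variable {H : Type*} [NormedAddCommGroup H] [InnerProductSpace ℂ H]

theorem summable_norm_sq {E : Type*} [NormedAddCommGroup E] {ι : Type*}
    (f : lp (fun _ : ι => E) 2) :
    Summable fun i => ‖f i‖ ^ 2 := by
  simpa using (lp.memℓp f).summable (by norm_num)

theorem memℓp_two_of_summable {E : Type*} [NormedAddCommGroup E] {ι : Type*} {f : ι → E}
    (hf : Summable fun i => ‖f i‖ ^ 2) :
    Memℓp f 2 :=
  memℓp_gen (by simpa using hf)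

section Amplification

variable {ι : Type*}

/-- The diagonal action of an operator on a Hilbert sum of copies of `H`. -/
def amplification (x : H →L[ℂ] H) : lp (fun _ : ι => H) 2 →L[ℂ] lp (fun _ : ι => H) 2 :=
  have hx : ∀ (f : lp (fun _ : ι => H) 2) (i : ι), ‖x (f i)‖ ≤ ‖((‖x‖ : ℂ) • f) i‖ := fun f i => by
    rw [lp.coeFn_smul, Pi.smul_apply, norm_smul, Complex.norm_real, norm_norm]
    exact x.le_opNorm _
  LinearMap.mkContinuous
    { toFun := fun f => ⟨fun i => x (f i), memℓp_two_of_summable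
        (.of_nonneg_of_le (fun i => by positivity)
          (fun i => pow_le_pow_left₀ (norm_nonneg _) (hx f i) 2) (summable_norm_sq _))⟩
      map_add' := fun f g => lp.ext (funext fun i => map_add x _ _)
      map_smul' := fun c f => lp.ext (funext fun i => map_smul x _ _) } ‖x‖ fun f => by
    refine (lp.norm_mono two_ne_zero (hx f)).trans_eq ?_
    rw [norm_smul, Complex.norm_real, norm_norm]

@[simp]
theorem amplification_apply (x : H →L[ℂ] H) (f : lp (fun _ : ι => H) 2) (i : ι) :
    amplification x f i = x (f i) := rfl

theorem amplification_single [DecidableEq ι] (x : H →L[ℂ] H) (j : ι) (ξ : H) :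
    amplification x (lp.single 2 j ξ) = lp.single 2 j (x ξ) := by
  refine lp.ext (funext fun i => ?_)
  rw [amplification_apply]
  rcases eq_or_ne i j with rfl | h
  · simp
  · simp [h]

/-- The matrix coefficients of `P` lie in the commutant of `V`, so they commute with `x`; this is
checked on vectors supported at one index. -/
theorem amplification_commute_of_forall_commute [DecidableEq ι] {V : Set (H →L[ℂ] H)}
    {P : lp (fun _ : ι => H) 2 →L[ℂ] lp (fun _ : ι => H) 2}
    (hP : ∀ v ∈ V, ∀ f, P (amplification v f) = amplification v (P f))
    {x : H →L[ℂ] H} (hx : x ∈ Set.centralizer (Set.centralizer V)) (f : lp (fun _ : ι => H) 2) :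
    P (amplification x f) = amplification x (P f) := by
  let p : ι → ι → H →L[ℂ] H := fun i j =>
    lp.evalCLM ℂ (fun _ : ι => H) 2 i ∘L P ∘L lp.singleContinuousLinearMap ℂ (fun _ : ι => H) 2 j
  have hp : ∀ i j ξ, p i j ξ = P (lp.single 2 j ξ) i := fun i j ξ => rfl
  have hpV : ∀ i j, p i j ∈ Set.centralizer V := by
    intro i j
    refine Set.mem_centralizer_iff.2 fun v hv => ContinuousLinearMap.ext fun ξ => ?_
    change v (p i j ξ) = p i j (v ξ)
    rw [hp, hp, ← amplification_single, hP v hv, amplification_apply]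
  refine DFunLike.congr_fun (lp.ext_continuousLinearMap (by norm_num)
    (f := P ∘L amplification x) (g := amplification x ∘L P) fun j =>
      ContinuousLinearMap.ext fun ξ => lp.ext (funext fun i => ?_)) f
  change P (amplification x (lp.single 2 j ξ)) i = amplification x (P (lp.single 2 j ξ)) i
  rw [amplification_single, amplification_apply, ← hp, ← hp]
  exact (DFunLike.congr_fun (Set.mem_centralizer_iff.1 hx _ (hpV i j)) ξ)

variable [CompleteSpace H]

theorem inner_amplification_adjoint (x : H →L[ℂ] H) (f g : lp (fun _ : ι => H) 2) :
    ⟪amplification (ContinuousLinearMap.adjoint x) f, g⟫_ℂ = ⟪f, amplification x g⟫_ℂ := by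
  rw [lp.inner_eq_tsum, lp.inner_eq_tsum]
  exact tsum_congr fun i => ContinuousLinearMap.adjoint_inner_left x _ _

/-- The density part of von Neumann's bicommutant theorem. -/
theorem amplification_mem_closure (V : StarSubalgebra ℂ (H →L[ℂ] H)) {x : H →L[ℂ] H}
    (hx : x ∈ Set.centralizer (Set.centralizer (V : Set (H →L[ℂ] H))))
    (ξ : lp (fun _ : ι => H) 2) :
    amplification x ξ ∈ closure ((fun v => amplification v ξ) '' (V : Set (H →L[ℂ] H))) := by
  classical
  let E₀ : Submodule ℂ (lp (fun _ : ι => H) 2) := (Subalgebra.toSubmodule V.toSubalgebra).map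
    { toFun := fun v => amplification v ξ
      map_add' := fun v w => lp.ext (funext fun i => rfl)
      map_smul' := fun c v => lp.ext (funext fun i => by
        rw [RingHom.id_apply, lp.coeFn_smul]
        rfl) }
  have hE₀ : (E₀ : Set (lp (fun _ : ι => H) 2)) =
    (fun v => amplification v ξ) '' (V : Set (H →L[ℂ] H)) := rfl
  let E := E₀.topologicalClosure
  have : CompleteSpace E := E₀.isClosed_topologicalClosure.completeSpace_coe
  have hE : ∀ v ∈ V, ∀ f ∈ E, amplification v f ∈ E := by
    intro v hv f hf
    refine map_mem_closure (amplification v).continuous hf ?_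
    rintro _ ⟨w, hw, rfl⟩
    exact ⟨v * w, V.mul_mem hv hw, lp.ext (funext fun i => rfl)⟩
  -- `E`, the closure of `V ξ`, is invariant under the self-adjoint set `V`, and so is its
  -- orthogonal complement; hence the projection commutes with the amplification of `V`, and then
  -- with that of `x`. Since `1 ∈ V` gives `ξ ∈ E`, the vector `x ξ` lies in `E`.
  have hP : ∀ v ∈ V, ∀ f, E.starProjection (amplification v f) =
      amplification v (E.starProjection f) := by
    intro v hv f
    refine Submodule.eq_starProjection_of_mem_orthogonal
      (hE v hv _ (E.starProjection_apply_mem f)) ?_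
    rw [← map_sub]
    refine (E.mem_orthogonal _).2 fun g hg => ?_
    rw [← inner_amplification_adjoint]
    exact (E.mem_orthogonal _).1 (E.sub_starProjection_mem_orthogonal f) _
      (hE _ (star_mem hv) g hg)
  have hξ : ξ ∈ E := subset_closure ⟨1, V.one_mem, lp.ext (funext fun i => rfl)⟩
  have h := amplification_commute_of_forall_commute hP hx ξ
  rw [Submodule.starProjection_eq_self_iff.2 hξ] at h
  rw [← hE₀]
  exact Submodule.starProjection_eq_self_iff.1 h

end Amplification

theorem isInducing_uwFunctional [CompleteSpace H] :
    @IsInducing _ _ (ultraweakTopology H) _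
      fun (x : H →L[ℂ] H) (p : lp (fun _ : ℕ => H) 2 × lp (fun _ : ℕ => H) 2) =>
        uwFunctional p.1 p.2 x := by
  let _ := ultraweakTopology H
  refine ⟨?_⟩
  change ultraweakTopology H = TopologicalSpace.induced _ (⨅ p, _)
  rw [induced_iInf, iInf_prod]
  simp_rw [induced_compose]
  rfl

/-- Finitely many ultraweakly continuous functionals factor through a vector of an amplification. -/
theorem exists_continuous_amplification {I : Type*} [Finite I]
    (ξ η : I → lp (fun _ : ℕ => H) 2) :
    ∃ (ζ : lp (fun _ : I × ℕ => H) 2) (Ψ : lp (fun _ : I × ℕ => H) 2 → I → ℂ), Continuous Ψ ∧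
      ∀ x p, Ψ (amplification x ζ) p = uwFunctional (ξ p) (η p) x := by
  have hζ : Memℓp (fun q : I × ℕ => ξ q.1 q.2) 2 := memℓp_two_of_summable
    ((summable_prod_of_nonneg fun q => by positivity).2 ⟨fun p => summable_norm_sq (ξ p),
      .of_finite⟩)
  have hinj : ∀ p : I, Function.Injective fun n : ℕ => (p, n) := fun p => Prod.mk_right_injective p
  choose η' hη' _ using fun p => exists_lp_extend (hinj p) (summable_norm_sq (η p))
  obtain ⟨ζ, hζ⟩ : ∃ ζ : lp (fun _ : I × ℕ => H) 2, ∀ q, ζ q = ξ q.1 q.2 :=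
    ⟨⟨_, hζ⟩, fun _ => rfl⟩
  -- `ζ` stacks all the sequences `ξ p`, while `η' p` is `η p` placed on the slice `p` and zero
  -- elsewhere, so the inner product sees only that slice.
  refine ⟨ζ, fun g p => ⟪η' p, g⟫_ℂ, by fun_prop, fun x p => ?_⟩
  change ⟪η' p, amplification x ζ⟫_ℂ = _
  rw [lp.inner_eq_tsum, ← (hinj p).tsum_eq]
  · refine tsum_congr fun n => ?_
    rw [hη', (hinj p).extend_apply, amplification_apply, hζ]
  · refine Function.support_subset_iff'.2 fun q hq => ?_
    rw [hη', Function.extend_apply' _ _ _ hq]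
    simp

variable [CompleteSpace H]

/-- Von Neumann's bicommutant theorem, for the ultraweak topology. -/
theorem centralizer_centralizer_of_isClosed_ultraweak (V : StarSubalgebra ℂ (H →L[ℂ] H))
    (hV : IsClosed[ultraweakTopology H] (V : Set (H →L[ℂ] H))) :
    Set.centralizer (Set.centralizer (V : Set (H →L[ℂ] H))) = V := by
  refine subset_antisymm (fun x hx => ?_) Set.subset_centralizer_centralizer
  let τ := ultraweakTopology H
  have hcl := (isInducing_uwFunctional (H := H)).closure_eq_preimage_closure_image
    (V : Set (H →L[ℂ] H))
  rw [hV.closure_eq] at hcl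
  rw [hcl, mem_preimage, mem_closure_iff]
  intro o ho hxo
  obtain ⟨I, u, hu, hI⟩ := isOpen_pi_iff.1 ho _ hxo
  obtain ⟨ζ, Ψ, hΨ, heq⟩ := exists_continuous_amplification
    (fun p : I => p.1.1) (fun p : I => p.1.2)
  have hU : IsOpen (Ψ ⁻¹' univ.pi fun p : I => u p.1) :=
    (isOpen_set_pi finite_univ fun (p : I) _ => (hu p p.2).1).preimage hΨ
  obtain ⟨_, hv, v, hvV, rfl⟩ := mem_closure_iff.1 (amplification_mem_closure V hx ζ) _ hU
    (fun p _ => by rw [heq]; exact (hu p p.2).2)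
  refine ⟨_, hI fun p hp => ?_, v, hvV, rfl⟩
  have := hv ⟨p, hp⟩ trivial
  rwa [heq] at this

end Bicommutant

/-! ### The Grassmannian and the subalgebras inside the hyperspace of the unit ball. -/

section Grassmannian

theorem _root_.Topology.IsEmbedding.polishSpace_of_isGδ_range {X Y : Type*} [TopologicalSpace X]
    [TopologicalSpace Y] [PolishSpace Y] {f : X → Y} (hf : IsEmbedding f)
    (hr : IsGδ (range f)) : PolishSpace X :=
  have := hr.polishSpace
  hf.toHomeomorph.isClosedEmbedding.polishSpace

variable {H : Type*} [NormedAddCommGroup H] [InnerProductSpace ℂ H] [CompleteSpace H]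

namespace UnitBall

variable {M : VonNeumannAlgebra H}

theorem norm_smul_add_smul_le {a b : ℂ} (hab : ‖a‖ + ‖b‖ ≤ 1) {x y : H →L[ℂ] H} (hx : ‖x‖ ≤ 1)
    (hy : ‖y‖ ≤ 1) : ‖a • x + b • y‖ ≤ 1 := by
  refine (norm_add_le _ _).trans (le_trans ?_ hab)
  rw [norm_smul, norm_smul]
  exact add_le_add (mul_le_of_le_one_right (norm_nonneg _) hx)
    (mul_le_of_le_one_right (norm_nonneg _) hy)

/-- The combination `a x + b y` with `|a| + |b| ≤ 1`. -/
def comb (p : {p : ℂ × ℂ // ‖p.1‖ + ‖p.2‖ ≤ 1}) (x y : UnitBall M) : UnitBall M where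
  val := p.1.1 • x.val + p.1.2 • y.val
  mem := (asSubmodule M).add_mem ((asSubmodule M).smul_mem _ x.mem)
    ((asSubmodule M).smul_mem _ y.mem)
  norm_le := norm_smul_add_smul_le p.2 x.norm_le y.norm_le

instance : Zero (UnitBall M) := ⟨⟨0, (asSubmodule M).zero_mem, by simp⟩⟩

instance : One (UnitBall M) := ⟨⟨1, one_mem M, ContinuousLinearMap.norm_id_le⟩⟩

instance : Star (UnitBall M) := ⟨fun x => ⟨star x.val, star_mem x.mem, by
  rw [norm_star]
  exact x.norm_le⟩⟩

instance : Mul (UnitBall M) := ⟨fun x y => ⟨x.val * y.val, mul_mem x.mem y.mem,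
  (norm_mul_le _ _).trans (mul_le_one₀ x.norm_le (norm_nonneg _) y.norm_le)⟩⟩

theorem continuous_comb : Continuous fun q : {p : ℂ × ℂ // ‖p.1‖ + ‖p.2‖ ≤ 1} ×
    (UnitBall M × UnitBall M) => comb q.1 q.2.1 q.2.2 := by
  refine UnitBall.continuous_iff.2 fun ξ η => ?_
  have h : ∀ q : {p : ℂ × ℂ // ‖p.1‖ + ‖p.2‖ ≤ 1} × (UnitBall M × UnitBall M),
      ⟪η, (comb q.1 q.2.1 q.2.2).val ξ⟫_ℂ =
        q.1.1.1 * ⟪η, q.2.1.val ξ⟫_ℂ + q.1.1.2 * ⟪η, q.2.2.val ξ⟫_ℂ := fun q => by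
    simp only [comb, add_apply, smul_apply, inner_add_right, inner_smul_right]
  simp_rw [h]
  have h1 := (continuous_inner_unitBall M ξ η)
  exact .add (.mul (by fun_prop) (h1.comp (by fun_prop)))
    (.mul (by fun_prop) (h1.comp (by fun_prop)))

theorem continuous_star : Continuous fun x : UnitBall M => star x := by
  refine UnitBall.continuous_iff.2 fun ξ η => ?_
  refine (Complex.continuous_conj.comp (continuous_inner_unitBall M η ξ)).congr fun x => ?_
  change (starRingEnd ℂ) ⟪ξ, x.val η⟫_ℂ = ⟪η, ContinuousLinearMap.adjoint x.val ξ⟫_ℂ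
  rw [inner_conj_symm, ContinuousLinearMap.adjoint_inner_right]

theorem continuous_mul_const (y : UnitBall M) : Continuous fun x : UnitBall M => x * y :=
  UnitBall.continuous_iff.2 fun ξ η => continuous_inner_unitBall M (y.val ξ) η

theorem continuous_const_mul (x : UnitBall M) : Continuous fun y : UnitBall M => x * y := by
  refine UnitBall.continuous_iff.2 fun ξ η => ?_
  refine (continuous_inner_unitBall M ξ (ContinuousLinearMap.adjoint x.val η)).congr fun y => ?_
  rw [ContinuousLinearMap.adjoint_inner_left]
  rfl

theorem continuous_ofCLM_val :
    Continuous fun x : UnitBall M => (ContinuousLinearMapWOT.ofCLM x.val : H →WOT[ℂ] H) :=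
  ContinuousLinearMapWOT.continuous_iff.2 fun ξ η => continuous_inner_unitBall M ξ η

end UnitBall

instance : CompactSpace {p : ℂ × ℂ // ‖p.1‖ + ‖p.2‖ ≤ 1} := by
  refine isCompact_iff_compactSpace.1 ?_
  refine (isCompact_closedBall (0 : ℂ × ℂ) 1).of_isClosed_subset
    (isClosed_le ((continuous_norm.comp continuous_fst).add (continuous_norm.comp continuous_snd))
      continuous_const) fun p hp => ?_
  have hp' : ‖p.1‖ + ‖p.2‖ ≤ 1 := hp
  rw [mem_closedBall_zero_iff, Prod.norm_def]
  exact max_le (by linarith [norm_nonneg p.2]) (by linarith [norm_nonneg p.1])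

section

variable (M : VonNeumannAlgebra H)

/-- Compact subsets of the unit ball that are unit balls of ultraweakly closed subspaces. -/
def subspaceBalls : Set (Compacts (UnitBall M)) :=
  {F | 0 ∈ F} ∩ {F | ∀ p, ∀ q : UnitBall M × UnitBall M, q.1 ∈ F ∧ q.2 ∈ F →
      UnitBall.comb p q.1 q.2 ∈ F} ∩
    {F | ∀ x y : UnitBall M, x ∈ F ∧ y.val = (2 : ℂ) • x.val → y ∈ F}

/-- Compact subsets of the unit ball that contain the unit and are closed under the operations. -/
def starMulBalls : Set (Compacts (UnitBall M)) :=
  {F | 1 ∈ F} ∩ {F | ∀ x ∈ F, star x ∈ F} ∩ {F | ∀ x y : UnitBall M, x ∈ F ∧ y ∈ F → x * y ∈ F}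

end

section Compacts

variable {K X : Type*} [TopologicalSpace K] [TopologicalSpace X]

theorem isClosed_setOf_mem_compacts [T2Space K] {f : X → Compacts K}
    {g : X → K} (hf : Continuous f) (hg : Continuous g) : IsClosed {x | g x ∈ f x} :=
  isClosed_mem_compacts.preimage (hf.prodMk hg)

theorem polishSpace_compacts [CompactSpace K] [MetrizableSpace K] : PolishSpace (Compacts K) := by
  have : SecondCountableTopology K := by
    let _ := metrizableSpaceMetric K
    infer_instance
  let _ := metrizableSpaceMetric (Compacts K)
  infer_instance

theorem isGδ_compacts_mem [T2Space K] [MetrizableSpace K] (k : K) :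
    IsGδ {F : Compacts K | k ∈ F} := by
  simpa using isGδ_compacts_forall_mem (f := fun (_ : Unit) (_ : Unit) => k)
    (fun _ => continuous_const) (fun _ => continuous_const) isClosed_univ

end Compacts

theorem isGδ_subspaceBalls (M : VonNeumannAlgebra H) [MetrizableSpace (UnitBall M)] :
    IsGδ (subspaceBalls M) := by
  refine ((isGδ_compacts_mem 0).inter ?_).inter ?_
  · refine isGδ_compacts_forall_mem (f := fun p (q : UnitBall M × UnitBall M) =>
      UnitBall.comb p q.1 q.2) (R := {z | z.2.2.1 ∈ z.1} ∩ {z | z.2.2.2 ∈ z.1}) (fun p => ?_)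
      (fun q => ?_) ?_
    · exact UnitBall.continuous_comb.comp (continuous_const.prodMk continuous_id)
    · exact UnitBall.continuous_comb.comp (continuous_id.prodMk continuous_const)
    · exact (isClosed_setOf_mem_compacts (by fun_prop) (by fun_prop)).inter
        (isClosed_setOf_mem_compacts (by fun_prop) (by fun_prop))
  -- Doubling is only partially defined on the ball, so its closed graph is put into `R` and the
  -- operation merely returns the second coordinate.
  · refine isGδ_compacts_forall_mem (f := fun (_ y : UnitBall M) => y)
      (R := {z | z.2.1 ∈ z.1} ∩ {z | z.2.2.val = (2 : ℂ) • z.2.1.val}) (fun _ => continuous_id)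
      (fun _ => continuous_const) ?_
    refine (isClosed_setOf_mem_compacts (by fun_prop) (by fun_prop)).inter ?_
    have h := UnitBall.continuous_ofCLM_val (M := M)
    convert isClosed_eq
      (h.comp (continuous_snd.comp (continuous_snd (X := Compacts (UnitBall M)))))
      ((h.comp (continuous_fst.comp continuous_snd)).const_smul (2 : ℂ)) using 1
    ext z
    exact ContinuousLinearMapWOT.ofCLM_injective.eq_iff.symm

theorem isGδ_starMulBalls (M : VonNeumannAlgebra H) [MetrizableSpace (UnitBall M)] :
    IsGδ (starMulBalls M) := by
  refine ((isGδ_compacts_mem 1).inter ?_).inter ?_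
  · simpa using isGδ_compacts_forall_mem (f := fun (_ : Unit) (x : UnitBall M) => star x)
      (R := {z | z.2.2 ∈ z.1}) (fun _ => UnitBall.continuous_star) (fun _ => continuous_const)
      (isClosed_setOf_mem_compacts (by fun_prop) (by fun_prop))
  · exact isGδ_compacts_forall_mem (f := fun x y : UnitBall M => x * y)
      (R := {z | z.2.1 ∈ z.1} ∩ {z | z.2.2 ∈ z.1}) UnitBall.continuous_const_mul
      UnitBall.continuous_mul_const
      ((isClosed_setOf_mem_compacts (by fun_prop) (by fun_prop)).inter
        (isClosed_setOf_mem_compacts (by fun_prop) (by fun_prop)))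

namespace Grassmannian

variable {M : VonNeumannAlgebra H}

theorem ext {V W : Grassmannian M} (h : V.toSubmodule = W.toSubmodule) : V = W := by
  cases V; cases W; simp_all

/-- The unit ball of an ultraweakly closed subspace as a compact set. -/
def compactBall (V : Grassmannian M) : Compacts (UnitBall M) :=
  ⟨V.unitBall, V.unitBall.isClosed.isCompact⟩

theorem mem_compactBall {V : Grassmannian M} {x : UnitBall M} :
    x ∈ V.compactBall ↔ x.val ∈ V.toSubmodule := Iff.rfl

theorem exists_smul_mem_compactBall {V : Grassmannian M} {x : H →L[ℂ] H}
    (hx : x ∈ V.toSubmodule) : ∃ (c : ℂ), ∃ y ∈ V.compactBall, x = c • y.val := by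
  have hc : (0 : ℝ) < ‖x‖ + 1 := by positivity
  have hc' : ((‖x‖ + 1 : ℝ) : ℂ) ≠ 0 := by exact_mod_cast hc.ne'
  have hmem := V.toSubmodule.smul_mem ((‖x‖ + 1 : ℝ) : ℂ)⁻¹ hx
  refine ⟨((‖x‖ + 1 : ℝ) : ℂ), ⟨((‖x‖ + 1 : ℝ) : ℂ)⁻¹ • x, V.le hmem, ?_⟩, hmem, ?_⟩
  · rw [norm_smul, norm_inv, Complex.norm_real, Real.norm_of_nonneg hc.le, inv_mul_le_iff₀ hc]
    linarith
  · rw [smul_smul, mul_inv_cancel₀ hc', one_smul]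

theorem isEmbedding_compactBall : IsEmbedding (compactBall : Grassmannian M → _) := by
  refine ⟨⟨?_⟩, fun V W h => ext (le_antisymm ?_ ?_)⟩
  · change TopologicalSpace.induced _ (TopologicalSpace.induced _ _) =
      TopologicalSpace.induced _ (TopologicalSpace.induced _ _)
    rw [induced_compose, induced_compose]
    rfl
  all_goals
    intro x hx
    obtain ⟨c, y, hy, rfl⟩ := exists_smul_mem_compactBall hx
    refine Submodule.smul_mem _ c ?_
  · rwa [h] at hy
  · rwa [← h] at hy

/-- The subspace spanned by a set in `subspaceBalls`. -/
def spanBall (F : Compacts (UnitBall M)) (hF : F ∈ subspaceBalls M) :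
    Submodule ℂ (H →L[ℂ] H) where
  carrier := {x | ∃ c : ℂ, ∃ y ∈ F, x = c • y.val}
  zero_mem' := ⟨0, 0, hF.1.1, by simp⟩
  add_mem' := by
    rintro _ _ ⟨c, y, hy, rfl⟩ ⟨d, z, hz, rfl⟩
    have hs : (0 : ℝ) < ‖c‖ + ‖d‖ + 1 := by positivity
    have hs' : ((‖c‖ + ‖d‖ + 1 : ℝ) : ℂ) ≠ 0 := by exact_mod_cast hs.ne'
    -- Dividing by `‖c‖ + ‖d‖ + 1` makes the coefficients admissible for `comb`; the 1 avoids
    -- division by zero.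
    refine ⟨((‖c‖ + ‖d‖ + 1 : ℝ) : ℂ), _, hF.1.2 ⟨(((‖c‖ + ‖d‖ + 1 : ℝ) : ℂ)⁻¹ * c,
      ((‖c‖ + ‖d‖ + 1 : ℝ) : ℂ)⁻¹ * d), ?_⟩ (y, z) ⟨hy, hz⟩, ?_⟩
    · simp only [norm_mul, norm_inv, Complex.norm_real, Real.norm_of_nonneg hs.le]
      rw [← mul_add, inv_mul_le_iff₀ hs]
      linarith
    · simp only [UnitBall.comb, smul_add, smul_smul]
      rw [mul_inv_cancel_left₀ hs', mul_inv_cancel_left₀ hs']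
  smul_mem' := by
    rintro a _ ⟨c, y, hy, rfl⟩
    exact ⟨a * c, y, hy, smul_smul _ _ _⟩

theorem mem_of_val_eq_two_pow_smul {F : Compacts (UnitBall M)} (hF : F ∈ subspaceBalls M) (n : ℕ) :
    ∀ y ∈ F, ∀ x : UnitBall M, x.val = (2 : ℂ) ^ n • y.val → x ∈ F := by
  induction n with
  | zero =>
    intro y hy x hx
    rwa [UnitBall.ext (x := x) (y := y) (by simpa using hx)]
  | succ n ih =>
    intro y hy x hx
    -- The combination is `x / 2`, which stays in the ball of `M`, so the induction hypothesis
    -- applies to it and one doubling recovers `x`.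
    refine hF.2 (UnitBall.comb ⟨(2⁻¹, 0), by norm_num⟩ x x) x ⟨ih y hy _ ?_, ?_⟩
    · simp only [UnitBall.comb, hx, smul_smul, zero_mul, zero_smul, add_zero]
      congr 1
      rw [pow_succ]
      field_simp
    · simp [UnitBall.comb, smul_smul]

/-- If `x = c y` with `|c| < 2 ^ n`, then `2 ^ (-n) c y` lies in `F` by stability under
combinations, and `n` doublings within the ball lead back to `x`. -/
theorem mem_of_val_mem_spanBall {F : Compacts (UnitBall M)} (hF : F ∈ subspaceBalls M)
    {x : UnitBall M} (hx : x.val ∈ spanBall F hF) : x ∈ F := by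
  obtain ⟨c, y, hy, hxy⟩ := hx
  obtain ⟨n, hn⟩ := pow_unbounded_of_one_lt ‖c‖ (one_lt_two (α := ℝ))
  have h2 : (0 : ℝ) < 2 ^ n := by positivity
  refine mem_of_val_eq_two_pow_smul hF n _ (hF.1.2 ⟨((2 ^ n)⁻¹ * c, 0), ?_⟩ (y, y) ⟨hy, hy⟩) x ?_
  · simp only [norm_mul, norm_inv, norm_pow, Complex.norm_ofNat, norm_zero, add_zero]
    rw [inv_mul_le_iff₀ h2]
    linarith
  · simp only [UnitBall.comb, zero_smul, add_zero, smul_smul, hxy]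
    rw [mul_inv_cancel_left₀ (pow_ne_zero n two_ne_zero)]

theorem spanBall_le (F : Compacts (UnitBall M)) (hF : F ∈ subspaceBalls M) :
    spanBall F hF ≤ asSubmodule M := by
  rintro _ ⟨c, y, -, rfl⟩
  exact (asSubmodule M).smul_mem c y.mem

/-- The unit ball of the span is the image of the compact set `F`, so Krein–Šmulian applies. -/
theorem isClosed_spanBall (F : Compacts (UnitBall M)) (hF : F ∈ subspaceBalls M) :
    IsClosed[ultraweakTopology H] (spanBall F hF : Set (H →L[ℂ] H)) := by
  refine isClosed_ultraweak_of_isCompact_wotUnitBall ?_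
  convert F.isCompact.image UnitBall.continuous_ofCLM_val
  refine subset_antisymm (fun x hx => ?_) ?_
  · exact ⟨⟨x.toCLM, spanBall_le F hF hx.1, hx.2⟩, mem_of_val_mem_spanBall hF hx.1, rfl⟩
  · rintro _ ⟨y, hy, rfl⟩
    exact ⟨⟨1, y, hy, (one_smul ℂ _).symm⟩, y.norm_le⟩

theorem range_compactBall : range (compactBall : Grassmannian M → _) = subspaceBalls M := by
  refine subset_antisymm ?_ fun F hF => ?_
  · rintro _ ⟨V, rfl⟩
    refine ⟨⟨V.toSubmodule.zero_mem, fun p q hq => ?_⟩, fun x y hxy => ?_⟩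
    · exact V.toSubmodule.add_mem (V.toSubmodule.smul_mem _ hq.1) (V.toSubmodule.smul_mem _ hq.2)
    · rw [mem_compactBall, hxy.2]
      exact V.toSubmodule.smul_mem _ hxy.1
  · refine ⟨⟨spanBall F hF, spanBall_le F hF, isClosed_spanBall F hF⟩, ?_⟩
    ext x
    exact ⟨mem_of_val_mem_spanBall hF, fun hx => ⟨1, x, hx, (one_smul ℂ _).symm⟩⟩

/-- The von Neumann algebra given by a subspace whose unit ball is closed under the operations. -/
def toVonNeumannAlgebra (V : Grassmannian M) (hV : V.compactBall ∈ starMulBalls M) :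
    VonNeumannAlgebra H :=
  have hone : (1 : H →L[ℂ] H) ∈ V.toSubmodule := hV.1.1
  let S : StarSubalgebra ℂ (H →L[ℂ] H) :=
    { V.toSubmodule with
      mul_mem' := by
        intro x y hx hy
        obtain ⟨c, x', hx', rfl⟩ := exists_smul_mem_compactBall hx
        obtain ⟨d, y', hy', rfl⟩ := exists_smul_mem_compactBall hy
        rw [smul_mul_smul_comm]
        exact V.toSubmodule.smul_mem _ (hV.2 x' y' ⟨hx', hy'⟩)
      one_mem' := hone
      algebraMap_mem' := fun c => by
        rw [Algebra.algebraMap_eq_smul_one]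
        exact V.toSubmodule.smul_mem c hone
      star_mem' := by
        intro x hx
        obtain ⟨c, x', hx', rfl⟩ := exists_smul_mem_compactBall hx
        rw [star_smul]
        exact V.toSubmodule.smul_mem _ (hV.1.2 x' hx') }
  { S with
    centralizer_centralizer' := centralizer_centralizer_of_isClosed_ultraweak S V.isClosed }

end Grassmannian

theorem Subalgebras.range_toGrassmannian (M : VonNeumannAlgebra H) :
    range (Subalgebras.toGrassmannian : Subalgebras M → Grassmannian M) =
      Grassmannian.compactBall ⁻¹' starMulBalls M := by
  refine subset_antisymm ?_ fun V hV => ?_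
  · rintro _ ⟨N, rfl⟩
    exact ⟨⟨one_mem N.toVonNeumannAlgebra, fun x hx => star_mem (S := VonNeumannAlgebra H) hx⟩,
      fun x y hxy => mul_mem (S := VonNeumannAlgebra H) hxy.1 hxy.2⟩
  · exact ⟨⟨V.toVonNeumannAlgebra hV, fun x hx => V.le hx⟩, rfl⟩

theorem Subalgebras.isEmbedding_toGrassmannian (M : VonNeumannAlgebra H) :
    IsEmbedding (Subalgebras.toGrassmannian : Subalgebras M → Grassmannian M) := by
  refine ⟨⟨rfl⟩, fun N N' h => ?_⟩
  have h1 : N.toVonNeumannAlgebra = N'.toVonNeumannAlgebra := VonNeumannAlgebra.ext fun x =>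
    SetLike.ext_iff.1 (congrArg Grassmannian.toSubmodule h) x
  cases N; cases N'; simp_all

end Grassmannian

end MarechalTopology

end

theorem mainTheorem1 {H : Type*} [NormedAddCommGroup H] [InnerProductSpace ℂ H] [CompleteSpace H]
    (M : VonNeumannAlgebra H)
    (hM : TopologicalSpace.SeparableSpace (MarechalTopology.predual M)) :
    PolishSpace (MarechalTopology.Grassmannian M) ∧
      IsGδ (Set.range
        (MarechalTopology.Subalgebras.toGrassmannian :
          MarechalTopology.Subalgebras M → MarechalTopology.Grassmannian M)) ∧
      PolishSpace (MarechalTopology.Subalgebras M) := by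
  have : TopologicalSpace.MetrizableSpace (MarechalTopology.UnitBall M) :=
    MarechalTopology.UnitBall.metrizableSpace M
  have := MarechalTopology.polishSpace_compacts (K := MarechalTopology.UnitBall M)
  have hemb := MarechalTopology.Grassmannian.isEmbedding_compactBall (M := M)
  have hG : PolishSpace (MarechalTopology.Grassmannian M) :=
    hemb.polishSpace_of_isGδ_range
      (MarechalTopology.Grassmannian.range_compactBall (M := M) ▸
        MarechalTopology.isGδ_subspaceBalls M)
  have hS : IsGδ (Set.range (MarechalTopology.Subalgebras.toGrassmannian :
      MarechalTopology.Subalgebras M → MarechalTopology.Grassmannian M)) := by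
    rw [MarechalTopology.Subalgebras.range_toGrassmannian]
    exact (MarechalTopology.isGδ_starMulBalls M).preimage hemb.continuous
  exact ⟨hG, hS,
    (MarechalTopology.Subalgebras.isEmbedding_toGrassmannian M).polishSpace_of_isGδ_range hS⟩
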